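/- Let $\mathcal{O}$ be the ring of entire functions on $\mathbb{C}$ with pointwise operations, let $R$ be a Bézout domain, and let $\mathscr{L}\colon R\to\mathcal{O}$ be an injective (unital) ring homomorphism. An $R$-system is an $R$-module. A finite matrix $P\in R^{q\times p}$ is a presentation matrix of an $R$-system $\Sigma$ if $\Sigma\cong R^{p}/N$, where $N$ is the submodule spanned by the rows of $P$. A finitely presented $R$-system $\Sigma$ is called torsion free controllable if it is a torsion free $R$-module (equivalently, $R\otimes_R\Sigma$ is torsion free). It is called spectrally controllable if it has a presentation matrix $P$ for which there is $k\in\mathbb{N}$ with $\operatorname{rank}\,\mathscr{L}(P)(\sigma)=k$ for all $\sigma\in\mathbb{C}$, where $\mathscr{L}$ is applied entrywise. Then spectral controllability is well defined: for every finitely presented $R$-system $\Sigma$ and every presentation matrix $P$ of $\Sigma$, $\Sigma$ is spectrally controllable if and only if the rank of $\mathscr{L}(P)(\sigma)$ does not depend on $\sigma\in\mathbb{C}$; and $\Sigma$ is spectrally controllable if and only if the $\mathcal{O}$-module $\mathcal{O}\otimes_R\Sigma$ (formed along $\mathscr{L}$) is free. Moreover, the following are equivalent: 1. for every finitely presented $R$-system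 $\Sigma$, $\Sigma$ is spectrally controllable if and only if it is torsion free controllable; 2. $\mathscr{L}$ maps every non-unit of $R$ to a non-unit of $\mathcal{O}$. -/

import Mathlib

open scoped TensorProduct

universe u v

/-- The ring `𝒪` of entire functions, with pointwise operations. -/
def EntireFunctions : Subring (ℂ → ℂ) where
  carrier := {f | Differentiable ℂ f}
  mul_mem' hf hg := Differentiable.mul hf hg
  one_mem' := differentiable_const 1
  add_mem' hf hg := Differentiable.add hf hg
  zero_mem' := differentiable_const 0
  neg_mem' hf := Differentiable.neg hf

/-- An `R`-system is an `R`-module `M`. The matrix `P` is a presentation matrix of `M` if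
`M ≅ [v] / [P v]`, where `[v]` is free with (finite) basis `v`; the entries of `P v` are the
rows of `P` in the basis `v`. -/
def IsPresentationMatrix {R : Type u} [CommRing R] {q p : ℕ} (P : Matrix (Fin q) (Fin p) R)
    (M : Type v) [AddCommGroup M] [Module R M] : Prop :=
  Nonempty (M ≃ₗ[R] ((Fin p → R) ⧸ Submodule.span R (Set.range P.row)))

/-- The `R`-system `M` is `A`-torsion free controllable: `A ⊗[R] M` is torsion free over `A`. -/
def IsTorsionFreeControllable (R : Type u) [CommRing R] (A : Type*) [CommRing A] [Algebra R A]
    (M : Type v) [AddCommGroup M] [Module R M] : Prop :=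
  Module.IsTorsionFree A (A ⊗[R] M)

/-- The matrix `L(P)(σ)` has the same rank at every complex number `σ`. -/
def HasConstantSpectralRank {R : Type u} [CommRing R] (L : R →+* EntireFunctions) {q p : ℕ}
    (P : Matrix (Fin q) (Fin p) R) : Prop :=
  ∃ k : ℕ, ∀ σ : ℂ, (P.map fun r => (L r : ℂ → ℂ) σ).rank = k

/-- The extension `𝒪 ⊗[R] M` of the `R`-system `M` along `L : R → 𝒪` is a free `𝒪`-module. -/
def IsFreeOverEntire {R : Type u} [CommRing R] (L : R →+* EntireFunctions)
    (M : Type v) [AddCommGroup M] [Module R M] : Prop :=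
  letI : Algebra R EntireFunctions := L.toAlgebra
  Module.Free EntireFunctions (EntireFunctions ⊗[R] M)

/-- Spectral controllability: `L(P)(σ)` has constant rank for a presentation matrix `P`. -/
def IsSpectrallyControllable {R : Type u} [CommRing R] (L : R →+* EntireFunctions)
    (M : Type v) [AddCommGroup M] [Module R M] : Prop :=
  ∃ (q p : ℕ) (P : Matrix (Fin q) (Fin p) R),
    IsPresentationMatrix P M ∧ HasConstantSpectralRank L P

/-!
Over a Bézout domain `R`, a finitely presented module `M` splits as `T × F`, where `T` is its
torsion submodule, again finitely presented, and `F` is free of finite rank. The rank of `L(P)(σ)`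
for a presentation matrix `P` with `p` columns is `p` minus the dimension of the fibre `ℂ ⊗ M` at
`σ`, which is the rank of `F` plus the dimension of the fibre of `T`
(`IsPresentationMatrix.rank_add_fibreDim`, `fibreDim_eq_add_finrank`). So constancy of the rank is
a property of `M`, and in fact of `T`.

Some `r ≠ 0` annihilates `T`, and `L(r)` is a nonzero entire function, so the fibre of `T` vanishes
somewhere; hence constant rank means that every fibre of `T` vanishes. As the relation modules of
`T` are free, `T` has a square presentation matrix, whose determinant `d` annihilates `T`. If every
fibre of `T` vanishes, `L(d)` has no zeros, that is, `L(d)` is a unit. This yields the common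
criterion behind all parts of the theorem: `M` is spectrally controllable if and only if `T` is
annihilated by some `d` with `L(d)` a unit (`isSpectrallyControllable_iff_exists_isUnit`). The
extension of `M` to the entire functions is free exactly when that of `T` vanishes, which amounts
to the same criterion (`isFreeOverEntire_iff_exists_isUnit`).

If `L` reflects units, such a `d` is a unit, so the criterion says `T = 0`. If `r` is a non-unit
with `L(r)` a unit, `R ⧸ (r)` is spectrally controllable but not torsion free.
-/

/-! ### Finitely generated modules over a Bézout domain -/

section Bezout

variable {R : Type*} [CommRing R]

/-- A surjection onto a projective module splits. -/
lemma nonempty_equiv_ker_prod_of_projective {M P : Type*} [AddCommGroup M] [Module R M]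
    [AddCommGroup P] [Module R P] [Module.Projective R P] (g : M →ₗ[R] P)
    (hg : Function.Surjective g) : Nonempty (M ≃ₗ[R] LinearMap.ker g × P) := by
  obtain ⟨l, hl⟩ := Module.projective_lifting_property g .id hg
  have hex := LinearMap.exact_subtype_ker_map g
  obtain ⟨e, -, -⟩ := (hex.split_tfae'.out 0 2 rfl rfl).mp ⟨Subtype.val_injective, l, hl⟩
  exact ⟨e⟩

variable [IsDomain R]

lemma Ideal.free_of_isPrincipal (I : Ideal R) (hI : I.IsPrincipal) : Module.Free R I := by
  obtain ⟨a, rfl⟩ := hI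
  by_cases ha : a = 0
  · subst ha
    have : Subsingleton (Submodule.span R {(0 : R)}) := by
      rw [Submodule.span_zero_singleton]; infer_instance
    infer_instance
  · exact Module.Free.of_equiv (LinearEquiv.toSpanNonzeroSingleton R R a ha)

variable [IsBezout R]

/-- A finitely generated submodule of `Rⁿ` is free over a Bézout domain `R`: its image under the
first coordinate is a principal ideal, hence free, so it splits off, and the kernel is a finitely
generated submodule of `Rⁿ⁻¹`. -/
lemma Module.Free.of_injective_of_isBezout (n : ℕ) {M : Type*} [AddCommGroup M] [Module R M]
    [Module.Finite R M] (f : M →ₗ[R] (Fin n → R)) (hf : Function.Injective f) :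
    Module.Free R M := by
  induction n generalizing M with
  | zero =>
    have := hf.subsingleton
    infer_instance
  | succ n ih =>
    let g : M →ₗ[R] R := LinearMap.proj 0 ∘ₗ f
    have : Module.Free R (LinearMap.range g) :=
      Ideal.free_of_isPrincipal _ (IsBezout.isPrincipal_of_FG _ (Submodule.fg_range g))
    obtain ⟨e⟩ := nonempty_equiv_ker_prod_of_projective g.rangeRestrict g.surjective_rangeRestrict
    have : Module.Finite R (LinearMap.ker g.rangeRestrict) :=
      .of_surjective (LinearMap.fst R _ _ ∘ₗ e.toLinearMap)
        (Prod.fst_surjective.comp e.surjective)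
    have : Module.Free R (LinearMap.ker g.rangeRestrict) := by
      refine ih (LinearMap.funLeft R R Fin.succ ∘ₗ f ∘ₗ Submodule.subtype _) fun x y hxy ↦ ?_
      refine Subtype.ext (hf (funext fun i ↦ ?_))
      have h0 : ∀ z : LinearMap.ker g.rangeRestrict, f z 0 = 0 := fun z ↦
        congrArg Subtype.val (LinearMap.mem_ker.mp z.2)
      refine Fin.cases ?_ (fun j ↦ ?_) i
      · rw [h0, h0]
      · exact congrFun hxy j
    exact Module.Free.of_equiv e.symm

lemma Submodule.FG.free_of_isBezout {n : ℕ} {N : Submodule R (Fin n → R)} (hN : N.FG) :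
    Module.Free R N :=
  have : Module.Finite R N := .of_fg hN
  Module.Free.of_injective_of_isBezout n N.subtype N.injective_subtype

/-- A finitely generated torsion free module `M` over a Bézout domain is free: a nonzero multiple of
`M`, which is isomorphic to `M`, lies in the span of a maximal linearly independent family of
generators. -/
lemma Module.Free.of_isTorsionFree_of_isBezout (M : Type*) [AddCommGroup M] [Module R M]
    [Module.Finite R M] [Module.IsTorsionFree R M] : Module.Free R M := by
  classical
  obtain ⟨n, s, hs⟩ := Module.Finite.exists_fin (R := R) (M := M)
  obtain ⟨I, indep, hI⟩ := exists_maximal_linearIndepOn R s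
  have hmem : ∀ i, ∃ a : R, a ≠ 0 ∧ a • s i ∈ Submodule.span R (s '' I) := by
    intro i
    by_cases hi : i ∈ I
    · exact ⟨1, one_ne_zero, by
        rw [one_smul]; exact Submodule.subset_span (Set.mem_image_of_mem s hi)⟩
    · exact hI i hi
  choose a ha ha' using hmem
  have hA : ∏ i, a i ≠ 0 := Finset.prod_ne_zero_iff.mpr fun i _ ↦ ha i
  have hle : ∀ x : M, (∏ i, a i) • x ∈ Submodule.span R (Set.range fun i : I ↦ s i) := by
    intro x
    have hx : x ∈ Submodule.span R (Set.range s) := hs ▸ Submodule.mem_top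
    rw [← Set.image_eq_range s I]
    induction hx using Submodule.span_induction with
    | mem x hx =>
      obtain ⟨i, rfl⟩ := hx
      rw [Fintype.prod_eq_prod_compl_mul i, mul_smul]
      exact Submodule.smul_mem _ _ (ha' i)
    | zero => simp
    | add x y _ _ hx hy => rw [smul_add]; exact add_mem hx hy
    | smul c x _ hx => rw [smul_comm]; exact Submodule.smul_mem _ _ hx
  let b : Module.Basis I R (Submodule.span R (Set.range fun i : I ↦ s i)) := .span indep
  let φ : M →ₗ[R] Submodule.span R (Set.range fun i : I ↦ s i) :=
    (LinearMap.lsmul R M (∏ i, a i)).codRestrict _ hle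
  have hφ : Function.Injective φ := fun x y hxy ↦
    smul_right_injective M hA (congrArg Subtype.val hxy)
  let e := (b.reindex (Fintype.equivFin I)).equivFun
  exact Module.Free.of_injective_of_isBezout _ (e.toLinearMap ∘ₗ φ) (e.injective.comp hφ)

/-- Over a Bézout domain, a finitely presented module is the direct sum of its torsion submodule,
which is again finitely presented, and a free module of finite rank. -/
lemma torsion_finitePresentation_and_equiv_prod_free (M : Type*) [AddCommGroup M] [Module R M]
    [Module.FinitePresentation R M] :
    Module.FinitePresentation R (Submodule.torsion R M) ∧
      Module.Free R (M ⧸ Submodule.torsion R M) ∧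
      Nonempty (M ≃ₗ[R] Submodule.torsion R M × (M ⧸ Submodule.torsion R M)) := by
  have : Module.Free R (M ⧸ Submodule.torsion R M) := .of_isTorsionFree_of_isBezout _
  have hsurj := (Submodule.torsion R M).mkQ_surjective
  refine ⟨Module.finitePresentation_of_projective_of_exact (Submodule.torsion R M).subtype
    (Submodule.torsion R M).mkQ Subtype.val_injective hsurj
    (LinearMap.exact_subtype_mkQ _), this, ?_⟩
  have := nonempty_equiv_ker_prod_of_projective _ hsurj
  rwa [Submodule.ker_mkQ] at this

end Bezout

/-! ### Presentation matrices -/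

section Presentation

variable {R : Type u} [CommRing R] {M : Type v} [AddCommGroup M] [Module R M]

lemma exists_isPresentationMatrix [Module.FinitePresentation R M] :
    ∃ (q p : ℕ) (P : Matrix (Fin q) (Fin p) R), IsPresentationMatrix P M := by
  obtain ⟨p, N, e, hN⟩ := Module.FinitePresentation.exists_fin R M
  obtain ⟨q, P, rfl⟩ := Submodule.fg_iff_exists_fin_generating_family.mp hN
  exact ⟨q, p, P, ⟨e⟩⟩

/-- A finitely presented torsion module over a Bézout domain has a square presentation matrix,
because the relation module is free of the same rank as the module of generators. -/
lemma exists_square_isPresentationMatrix [IsDomain R] [IsBezout R] [Module.FinitePresentation R M]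
    (hM : Module.IsTorsion R M) :
    ∃ (n : ℕ) (P : Matrix (Fin n) (Fin n) R), IsPresentationMatrix P M := by
  obtain ⟨n, N, e, hN⟩ := Module.FinitePresentation.exists_fin R M
  have := hN.free_of_isBezout
  have : Module.Finite R N := .of_fg hN
  have hM0 : Module.finrank R M = 0 := Module.finrank_eq_zero_iff_isTorsion.mpr hM
  have hrank : Module.finrank R N = n := by
    have := N.finrank_quotient_add_finrank
    rwa [← e.finrank_eq, hM0, zero_add, Module.finrank_fin_fun] at this
  let b := Module.finBasisOfFinrankEq R N hrank
  refine ⟨n, Matrix.of fun i ↦ (b i : Fin n → R), ⟨e.trans (Submodule.quotEquivOfEq _ _ ?_)⟩⟩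
  have hb := congrArg (Submodule.map N.subtype) b.span_eq
  rw [Submodule.map_span, Submodule.map_top, Submodule.range_subtype, ← Set.range_comp] at hb
  exact hb.symm

/-- By Cramer's rule, the determinant of a square presentation matrix annihilates the module. -/
lemma IsPresentationMatrix.det_smul_eq_zero {n : ℕ} {P : Matrix (Fin n) (Fin n) R}
    (h : IsPresentationMatrix P M) (x : M) : P.det • x = 0 := by
  obtain ⟨e⟩ := h
  apply e.injective
  rw [map_smul, map_zero]
  obtain ⟨v, hv⟩ := Submodule.Quotient.mk_surjective _ (e x)
  rw [← hv, ← Submodule.Quotient.mk_smul, Submodule.Quotient.mk_eq_zero]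
  have hdet : P.det • v = Matrix.vecMul (Matrix.vecMul v P.adjugate) P := by
    rw [Matrix.vecMul_vecMul, Matrix.adjugate_mul, Matrix.vecMul_smul, Matrix.vecMul_one]
  rw [hdet, Matrix.vecMul_eq_sum]
  exact Submodule.sum_mem _ fun i _ ↦ Submodule.smul_mem _ _ (Submodule.subset_span ⟨i, rfl⟩)

/-- The rank of the presentation matrix over a field `K` is determined by the number of its columns
and the dimension of `K ⊗ M`. -/
lemma IsPresentationMatrix.rank_map_add_finrank {q p : ℕ} {P : Matrix (Fin q) (Fin p) R}
    (h : IsPresentationMatrix P M) (K : Type*) [Field K] [Algebra R K] :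
    (P.map (algebraMap R K)).rank + Module.finrank K (K ⊗[R] M) = p := by
  obtain ⟨e⟩ := h
  set N := Submodule.span R (Set.range P.row) with hN
  let g : (Fin p → R) →ₗ[R] M := e.symm.toLinearMap ∘ₗ N.mkQ
  have hg : Function.Surjective g := e.symm.surjective.comp N.mkQ_surjective
  have hex : Function.Exact N.subtype g :=
    e.symm.injective.comp_exact_iff_exact.mpr (LinearMap.exact_subtype_mkQ N)
  have hker : LinearMap.ker (g.baseChange K) = N.baseChange K :=
    LinearMap.exact_iff.mp (show Function.Exact (N.subtype.baseChange K) (g.baseChange K) from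
      lTensor_exact K hex hg)
  have hrange : LinearMap.range (g.baseChange K) = ⊤ :=
    LinearMap.range_eq_top.mpr (LinearMap.lTensor_surjective K hg)
  have hadd := (g.baseChange K).finrank_range_add_finrank_ker
  let E := TensorProduct.piScalarRight R K K (Fin p)
  have hE : (N.baseChange K).map E.toLinearMap =
      Submodule.span K (Set.range (P.map (algebraMap R K)).row) := by
    rw [hN, Submodule.baseChange_span, Submodule.map_span, ← Set.image_comp, ← Set.range_comp]
    congr 2
    ext i j
    simp [E, Algebra.smul_def]
  have hfin : Module.finrank K (K ⊗[R] (Fin p → R)) = p := by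
    rw [E.finrank_eq, Module.finrank_fin_fun]
  rw [hrange, finrank_top, hfin, hker, ← LinearEquiv.finrank_map_eq E, hE,
    ← Matrix.rank_eq_finrank_span_row] at hadd
  omega

end Presentation

/-! ### Extension of scalars -/

section BaseChange

variable {R : Type*} [CommRing R] {A : Type*} [CommRing A] [Algebra R A]
  {T : Type*} [AddCommGroup T] [Module R T]

lemma TensorProduct.subsingleton_of_isUnit_of_smul_eq_zero {d : R}
    (hd : IsUnit (algebraMap R A d)) (hT : ∀ x : T, d • x = 0) : Subsingleton (A ⊗[R] T) := by
  refine subsingleton_of_forall_eq 0 fun z ↦ ?_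
  have hz : algebraMap R A d • z = 0 := by
    induction z with
    | zero => simp
    | tmul a x => rw [algebraMap_smul, ← TensorProduct.tmul_smul, hT, TensorProduct.tmul_zero]
    | add y z hy hz => rw [smul_add, hy, hz, add_zero]
  exact hd.smul_eq_zero.mp hz

/-- An `R`-linear map `A → B` sending `1` to `1` carries vanishing of `A ⊗ T` over to `B ⊗ T`. -/
lemma TensorProduct.subsingleton_of_linearMap {B : Type*} [CommRing B] [Algebra R B]
    (f : A →ₗ[R] B) (hf : f 1 = 1) [Subsingleton (A ⊗[R] T)] : Subsingleton (B ⊗[R] T) := by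
  have h1 : ∀ x : T, (1 : B) ⊗ₜ[R] x = 0 := fun x ↦ by
    rw [← hf, ← LinearMap.rTensor_tmul, Subsingleton.elim ((1 : A) ⊗ₜ[R] x) 0, map_zero]
  refine subsingleton_of_forall_eq 0 fun z ↦ ?_
  induction z with
  | zero => rfl
  | tmul b x => rw [← mul_one b, ← smul_eq_mul, ← TensorProduct.smul_tmul', h1, smul_zero]
  | add y z hy hz => rw [hy, hz, add_zero]

/-- The scalar extension of a finitely generated torsion module along an injection of domains is
again torsion, so it vanishes as soon as it embeds into a free module. -/
lemma Module.IsTorsion.free_baseChange_iff [Nontrivial R] [IsDomain A] [FaithfulSMul R A]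
    [Module.Finite R T] (hT : Module.IsTorsion R T) {M F : Type*} [AddCommGroup M] [Module R M]
    [AddCommGroup F] [Module R F] [Module.Free R F] (e : M ≃ₗ[R] T × F) :
    Module.Free A (A ⊗[R] M) ↔ Subsingleton (A ⊗[R] T) := by
  let E : A ⊗[R] M ≃ₗ[A] (A ⊗[R] T) × (A ⊗[R] F) :=
    e.baseChange R A M (T × F) ≪≫ₗ TensorProduct.prodRight R A A T F
  constructor
  · intro _
    obtain ⟨r, hr, hr0⟩ := Submodule.annihilator_top_inter_nonZeroDivisors hT
    have hr' : algebraMap R A r ∈ nonZeroDivisors A :=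
      map_mem_nonZeroDivisors _ (FaithfulSMul.algebraMap_injective R A) hr0
    have hfree : Module.Free A ((A ⊗[R] T) × (A ⊗[R] F)) := .of_equiv E
    refine subsingleton_of_forall_eq 0 fun z ↦ ?_
    have hz : algebraMap R A r • z = 0 := by
      induction z with
      | zero => simp
      | tmul a x =>
        rw [algebraMap_smul, ← TensorProduct.tmul_smul,
          Submodule.mem_annihilator.mp hr x Submodule.mem_top, TensorProduct.tmul_zero]
      | add y z hy hz => rw [smul_add, hy, hz, add_zero]
    have hz' : algebraMap R A r • (z, (0 : A ⊗[R] F)) = 0 := by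
      rw [Prod.smul_mk, hz, smul_zero]; rfl
    exact congrArg Prod.fst
      ((smul_eq_zero_iff_right (nonZeroDivisors.ne_zero hr')).mp hz')
  · intro _
    exact Module.Free.of_equiv E.symm

end BaseChange

/-! ### Entire functions -/

namespace EntireFunctions

/-- Evaluation of entire functions at a point. -/
def eval (σ : ℂ) : EntireFunctions →+* ℂ := (Pi.evalRingHom _ σ).comp EntireFunctions.subtype

instance : Nontrivial EntireFunctions :=
  ⟨0, 1, fun h ↦ zero_ne_one (congrArg (eval 0) h)⟩

/-- Zero divisors are excluded by the identity theorem. -/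
instance : NoZeroDivisors EntireFunctions where
  eq_zero_or_eq_zero_of_mul_eq_zero {f g} hfg := by
    have hf : AnalyticOnNhd ℂ (f : ℂ → ℂ) Set.univ := fun z _ ↦ f.2.analyticAt z
    have hg : AnalyticOnNhd ℂ (g : ℂ → ℂ) Set.univ := fun z _ ↦ g.2.analyticAt z
    refine (hf.eq_zero_or_eq_zero_of_mul_eq_zero hg (fun z _ ↦ congrArg (eval z) hfg)
      isPreconnected_univ).imp (fun h ↦ ?_) (fun h ↦ ?_) <;>
    exact Subtype.ext (funext fun z ↦ h z trivial)

instance : IsDomain EntireFunctions := NoZeroDivisors.to_isDomain _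

lemma isUnit_iff (f : EntireFunctions) : IsUnit f ↔ ∀ σ, eval σ f ≠ 0 := by
  refine ⟨fun h σ ↦ (h.map (eval σ)).ne_zero, fun h ↦ ?_⟩
  exact .of_mul_eq_one ⟨fun z ↦ ((f : ℂ → ℂ) z)⁻¹, Differentiable.inv f.2 h⟩
    (Subtype.ext (funext fun z ↦ mul_inv_cancel₀ (h z)))

lemma exists_eval_ne_zero {f : EntireFunctions} (hf : f ≠ 0) : ∃ σ, eval σ f ≠ 0 := by
  by_contra! h
  exact hf (Subtype.ext (funext h))

end EntireFunctions

/-! ### Fibres of a module along the evaluations -/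

section Fibre

open EntireFunctions

variable {R : Type u} [CommRing R] (L : R →+* EntireFunctions)

/-- The dimension of the fibre `ℂ ⊗[R] M` of the `R`-module `M` at `σ`, where `R` acts on `ℂ`
through `r ↦ L(r)(σ)`. -/
noncomputable def fibreDim (σ : ℂ) (M : Type v) [AddCommGroup M] [Module R M] : ℕ :=
  letI : Algebra R ℂ := ((eval σ).comp L).toAlgebra
  Module.finrank ℂ (ℂ ⊗[R] M)

variable {M : Type v} [AddCommGroup M] [Module R M]

lemma IsPresentationMatrix.rank_add_fibreDim {q p : ℕ} {P : Matrix (Fin q) (Fin p) R}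
    (h : IsPresentationMatrix P M) (σ : ℂ) :
    (P.map fun r ↦ (L r : ℂ → ℂ) σ).rank + fibreDim L σ M = p :=
  let _ : Algebra R ℂ := ((eval σ).comp L).toAlgebra
  h.rank_map_add_finrank ℂ

/-- Constancy of the rank of a presentation matrix is a property of the module. -/
lemma IsPresentationMatrix.hasConstantSpectralRank_iff {q p : ℕ} {P : Matrix (Fin q) (Fin p) R}
    (h : IsPresentationMatrix P M) :
    HasConstantSpectralRank L P ↔ ∀ σ τ, fibreDim L σ M = fibreDim L τ M := by
  have hr := h.rank_add_fibreDim L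
  constructor
  · rintro ⟨k, hk⟩ σ τ
    have h1 := hr σ
    have h2 := hr τ
    rw [hk] at h1 h2
    omega
  · intro hc
    refine ⟨(P.map fun r ↦ (L r : ℂ → ℂ) 0).rank, fun σ ↦ ?_⟩
    have h1 := hr σ
    have h2 := hr 0
    rw [hc σ 0] at h1
    omega

lemma isSpectrallyControllable_iff_fibreDim [Module.FinitePresentation R M] :
    IsSpectrallyControllable L M ↔ ∀ σ τ, fibreDim L σ M = fibreDim L τ M := by
  constructor
  · rintro ⟨q, p, P, hP, hc⟩
    exact (hP.hasConstantSpectralRank_iff L).mp hc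
  · intro hc
    obtain ⟨q, p, P, hP⟩ := exists_isPresentationMatrix (R := R) (M := M)
    exact ⟨q, p, P, hP, (hP.hasConstantSpectralRank_iff L).mpr hc⟩

lemma fibreDim_eq_add_finrank [Nontrivial R] {T F : Type*} [AddCommGroup T] [Module R T]
    [Module.Finite R T] [AddCommGroup F] [Module R F] [Module.Free R F] [Module.Finite R F]
    (e : M ≃ₗ[R] T × F) (σ : ℂ) :
    fibreDim L σ M = fibreDim L σ T + Module.finrank R F := by
  let _ : Algebra R ℂ := ((eval σ).comp L).toAlgebra
  let E : ℂ ⊗[R] M ≃ₗ[ℂ] (ℂ ⊗[R] T) × (ℂ ⊗[R] F) :=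
    e.baseChange R ℂ M (T × F) ≪≫ₗ TensorProduct.prodRight R ℂ ℂ T F
  calc Module.finrank ℂ (ℂ ⊗[R] M)
      = Module.finrank ℂ (ℂ ⊗[R] T) + Module.finrank ℂ (ℂ ⊗[R] F) := by
        rw [E.finrank_eq, Module.finrank_prod]
    _ = Module.finrank ℂ (ℂ ⊗[R] T) + Module.finrank R F := by rw [Module.finrank_baseChange (M' := F)]

lemma fibreDim_eq_zero_of_smul_eq_zero {σ : ℂ} {d : R} (hd : eval σ (L d) ≠ 0)
    (hM : ∀ x : M, d • x = 0) : fibreDim L σ M = 0 := by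
  let _ : Algebra R ℂ := ((eval σ).comp L).toAlgebra
  have := TensorProduct.subsingleton_of_isUnit_of_smul_eq_zero (A := ℂ) (T := M)
    (d := d) (IsUnit.mk0 _ hd) hM
  exact Module.finrank_zero_of_subsingleton

variable [IsDomain R] [IsBezout R] [Module.FinitePresentation R M]

/-- If all fibres of a torsion module vanish, then the determinant of a square presentation matrix
has no zeros in `ℂ`, and it annihilates the module. -/
lemma exists_isUnit_of_fibreDim_eq_zero (hM : Module.IsTorsion R M)
    (h : ∀ σ, fibreDim L σ M = 0) : ∃ d : R, IsUnit (L d) ∧ ∀ x : M, d • x = 0 := by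
  obtain ⟨n, P, hP⟩ := exists_square_isPresentationMatrix hM
  refine ⟨P.det, (isUnit_iff _).mpr fun σ ↦ ?_, hP.det_smul_eq_zero⟩
  have hrank := hP.rank_add_fibreDim L σ
  rw [h σ, add_zero, Matrix.rank_eq_finrank_span_row] at hrank
  have hli : LinearIndependent ℂ (P.map fun r ↦ (L r : ℂ → ℂ) σ).row :=
    linearIndependent_iff_card_eq_finrank_span.mpr (by rw [Fintype.card_fin]; exact hrank.symm)
  have hdet := ((Matrix.isUnit_iff_isUnit_det _).mp
    (Matrix.linearIndependent_rows_iff_isUnit.mp hli)).ne_zero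
  change ((eval σ).comp L) P.det ≠ 0
  rw [RingHom.map_det]
  exact hdet

/-- A torsion module is annihilated by a nonzero `r`, so its fibre vanishes at every `σ` with
`L(r)(σ) ≠ 0`. Constant fibre dimension is therefore dimension zero. -/
lemma Module.IsTorsion.fibreDim_const_iff (hL : Function.Injective L)
    (hM : Module.IsTorsion R M) :
    (∀ σ τ, fibreDim L σ M = fibreDim L τ M) ↔
      ∃ d : R, IsUnit (L d) ∧ ∀ x : M, d • x = 0 := by
  constructor
  · intro hc
    obtain ⟨r, hr, hr0⟩ := Submodule.annihilator_top_inter_nonZeroDivisors hM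
    obtain ⟨τ, hτ⟩ := exists_eval_ne_zero
      ((map_ne_zero_iff L hL).mpr (nonZeroDivisors.ne_zero hr0))
    refine exists_isUnit_of_fibreDim_eq_zero L hM fun σ ↦ ?_
    rw [hc σ τ]
    exact fibreDim_eq_zero_of_smul_eq_zero L hτ fun x ↦
      Submodule.mem_annihilator.mp hr x Submodule.mem_top
  · rintro ⟨d, hd, hx⟩ σ τ
    rw [fibreDim_eq_zero_of_smul_eq_zero L ((isUnit_iff _).mp hd σ) hx,
      fibreDim_eq_zero_of_smul_eq_zero L ((isUnit_iff _).mp hd τ) hx]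

/-- A module is spectrally controllable if and only if its torsion submodule is annihilated by some
`d` such that `L(d)` has no zeros. -/
lemma isSpectrallyControllable_iff_exists_isUnit (hL : Function.Injective L) :
    IsSpectrallyControllable L M ↔
      ∃ d : R, IsUnit (L d) ∧ ∀ x : Submodule.torsion R M, d • x = 0 := by
  obtain ⟨_, _, ⟨e⟩⟩ := torsion_finitePresentation_and_equiv_prod_free (R := R) M
  have hT : Module.IsTorsion R (Submodule.torsion R M) := Submodule.torsion_isTorsion
  rw [isSpectrallyControllable_iff_fibreDim, ← hT.fibreDim_const_iff L hL]
  simp only [fibreDim_eq_add_finrank L e, add_left_inj]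

/-- Scalar extension to the entire functions is free exactly under the same condition on the torsion
submodule: freeness forces the extended torsion to vanish, and with it all its fibres. -/
lemma isFreeOverEntire_iff_exists_isUnit (hL : Function.Injective L) :
    IsFreeOverEntire L M ↔
      ∃ d : R, IsUnit (L d) ∧ ∀ x : Submodule.torsion R M, d • x = 0 := by
  obtain ⟨_, _, ⟨e⟩⟩ := torsion_finitePresentation_and_equiv_prod_free (R := R) M
  let _ : Algebra R EntireFunctions := L.toAlgebra
  have : FaithfulSMul R EntireFunctions := (faithfulSMul_iff_algebraMap_injective _ _).mpr hL
  have hT : Module.IsTorsion R (Submodule.torsion R M) := Submodule.torsion_isTorsion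
  refine (hT.free_baseChange_iff (A := EntireFunctions) e).trans ⟨fun _ ↦ ?_, ?_⟩
  · refine exists_isUnit_of_fibreDim_eq_zero L hT fun σ ↦ ?_
    let _ : Algebra R ℂ := ((eval σ).comp L).toAlgebra
    let f : EntireFunctions →ₐ[R] ℂ := { eval σ with commutes' := fun _ ↦ rfl }
    have := TensorProduct.subsingleton_of_linearMap (T := Submodule.torsion R M)
      f.toLinearMap (map_one f)
    exact Module.finrank_zero_of_subsingleton
  · rintro ⟨d, hd, hx⟩
    exact TensorProduct.subsingleton_of_isUnit_of_smul_eq_zero hd hx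

end Fibre

/-! ### Torsion free controllability -/

lemma isTorsionFreeControllable_self_iff {R : Type u} [CommRing R] [IsDomain R] {M : Type v}
    [AddCommGroup M] [Module R M] :
    IsTorsionFreeControllable R R M ↔ Submodule.torsion R M = ⊥ := by
  rw [← Submodule.isTorsionFree_iff_torsion_eq_bot]
  let e := TensorProduct.lid R M
  exact ⟨fun (_ : Module.IsTorsionFree R (R ⊗[R] M)) ↦
      e.symm.injective.moduleIsTorsionFree _ (map_smul e.symm),
    fun _ ↦ e.injective.moduleIsTorsionFree _ (map_smul e)⟩

/-- A model of the cyclic module `R ⧸ (r)` in an arbitrary universe. It exists because `R` embeds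
into the ring of entire functions. -/
lemma exists_cyclic_model {R : Type u} [CommRing R] {L : R →+* EntireFunctions}
    (hL : Function.Injective L) (r : R) :
    ∃ (M : Type v) (_ : AddCommGroup M) (_ : Module R M),
      Module.FinitePresentation R M ∧ Nonempty (M ≃ₗ[R] R ⧸ Ideal.span {r}) := by
  have : Small.{v} R := small_of_injective hL
  have : Small.{v} (R ⧸ Ideal.span {r}) := small_of_surjective Ideal.Quotient.mk_surjective
  have : Module.FinitePresentation R (R ⧸ Ideal.span {r}) :=
    Module.finitePresentation_of_surjective (Ideal.span {r}).mkQ (Submodule.mkQ_surjective _)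
      (by rw [Submodule.ker_mkQ]; exact ⟨{r}, by simp⟩)
  let e : Shrink.{v} (R ⧸ Ideal.span {r}) ≃ₗ[R] R ⧸ Ideal.span {r} := Shrink.linearEquiv R _
  exact ⟨_, _, _, .of_equiv e.symm, ⟨e⟩⟩

theorem mainTheorem5 {R : Type u} [CommRing R] [IsDomain R] [IsBezout R]
    (L : R →+* EntireFunctions) (hL : Function.Injective L) :
    -- spectral controllability does not depend on the presentation matrix and can be
    -- tested by freeness over the ring of entire functions
    (∀ (M : Type v) [AddCommGroup M] [Module R M] [Module.FinitePresentation R M],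
      (∀ (q p : ℕ) (P : Matrix (Fin q) (Fin p) R), IsPresentationMatrix P M →
        (IsSpectrallyControllable L M ↔ HasConstantSpectralRank L P)) ∧
      (IsSpectrallyControllable L M ↔ IsFreeOverEntire L M)) ∧
    -- the equivalence of the two notions of controllability
    ((∀ (M : Type v) [AddCommGroup M] [Module R M] [Module.FinitePresentation R M],
        IsSpectrallyControllable L M ↔ IsTorsionFreeControllable R R M) ↔
      ∀ r : R, ¬ IsUnit r → ¬ IsUnit (L r)) := by
  refine ⟨fun M _ _ _ ↦ ⟨fun q p P hP ↦ ?_, ?_⟩, fun h r hr hLr ↦ hr ?_, fun h M _ _ _ ↦ ?_⟩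
  · rw [isSpectrallyControllable_iff_fibreDim, hP.hasConstantSpectralRank_iff]
  · rw [isSpectrallyControllable_iff_exists_isUnit L hL, isFreeOverEntire_iff_exists_isUnit L hL]
  · -- `R ⧸ (r)` is annihilated by `r`, so it is spectrally controllable, hence torsion free;
    -- being annihilated by `r ≠ 0` it vanishes
    obtain ⟨M, _, _, _, ⟨e⟩⟩ := exists_cyclic_model.{u, v} hL r
    have hr0 : r ≠ 0 := by
      rintro rfl
      exact hLr.ne_zero (map_zero L)
    have hann : ∀ x : M, r • x = 0 := fun x ↦ e.injective <| by
      obtain ⟨s, hs⟩ := Ideal.Quotient.mk_surjective (e x)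
      rw [map_smul, map_zero, ← hs, Algebra.smul_def, Ideal.Quotient.algebraMap_eq, ← map_mul,
        Ideal.Quotient.eq_zero_iff_mem]
      exact Ideal.mul_mem_right _ _ (Ideal.mem_span_singleton_self r)
    have hsc : IsSpectrallyControllable L M :=
      (isSpectrallyControllable_iff_exists_isUnit L hL).mpr
        ⟨r, hLr, fun x ↦ Subtype.ext (hann x)⟩
    have htf := Submodule.isTorsionFree_iff_torsion_eq_bot.mpr
      (isTorsionFreeControllable_self_iff.mp ((h M).mp hsc))
    have h1 : (Ideal.Quotient.mk (Ideal.span {r})) 1 = 0 := by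
      have := (smul_eq_zero_iff_right hr0).mp (hann (e.symm (Ideal.Quotient.mk _ 1)))
      rwa [e.symm.map_eq_zero_iff] at this
    rwa [Ideal.Quotient.eq_zero_iff_mem, ← Ideal.eq_top_iff_one, Ideal.span_singleton_eq_top] at h1
  · rw [isSpectrallyControllable_iff_exists_isUnit L hL, isTorsionFreeControllable_self_iff]
    constructor
    · rintro ⟨d, hd, hx⟩
      have hd' : IsUnit d := not_imp_not.mp (h d) hd
      exact (Submodule.eq_bot_iff _).mpr fun x hxT ↦
        congrArg Subtype.val (hd'.smul_eq_zero.mp (hx ⟨x, hxT⟩))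
    · intro hT
      refine ⟨1, by rw [map_one]; exact isUnit_one, fun x ↦ ?_⟩
      rw [one_smul]
      exact Subtype.ext ((Submodule.eq_bot_iff _).mp hT x x.2)
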